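/- \textbf{Setting.} Let $\mathcal{X}\subset\mathbb{R}^d$ with its Borel $\sigma$-algebra, $\mathcal{Y}=\{1,\dots,K\}$ (the ID labels) and $\mathcal{Y}_{\rm all}=\mathcal{Y}\cup\{K+1\}$, where $K+1$ is the OOD label. Let $\ell:\mathcal{Y}_{\rm all}\times\mathcal{Y}_{\rm all}\to\mathbb{R}_{\ge 0}$ satisfy $\ell(y_1,y_2)=0$ if and only if $y_1=y_2$. A \emph{domain} $D_{XY}=(1-\pi^{\rm out})D_{X_{\rm I}Y_{\rm I}}+\pi^{\rm out}D_{X_{\rm O}Y_{\rm O}}$ is given by a probability measure $D_{X_{\rm I}Y_{\rm I}}$ on $\mathcal{X}\times\mathcal{Y}$, a probability measure $D_{X_{\rm O}Y_{\rm O}}$ on $\mathcal{X}\times\{K+1\}$, and a number $\pi^{\rm out}\in[0,1)$; the marginals on $\mathcal{X}$ are $D_{X_{\rm I}}$ and $D_{X_{\rm O}}$. For measurable $h:\mathcal{X}\to\mathcal{Y}_{\rm all}$ put $R_D(h)=\mathbb{E}_{(x,y)\sim D_{XY}}\,\ell(h(x),y)$ and, for $\alpha\in[0,1]$, $R_D^{\alpha}(h)=(1-\alpha)\,\mathbb{E}_{(x,y)\sim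 D_{X_{\rm I}Y_{\rm I}}}\ell(h(x),y)+\alpha\,\mathbb{E}_{x\sim D_{X_{\rm O}}}\ell(h(x),K+1)$. Let $\mu$ be a measure on $\mathcal{X}$ and $b>0$. A \emph{density-based space} $\mathscr{D}^{\mu,b}_{XY}$ is a set of domains such that (i) (prior-unknown) for every $D_{XY}\in\mathscr{D}^{\mu,b}_{XY}$ and $\alpha\in[0,1)$, the domain $(1-\alpha)D_{X_{\rm I}Y_{\rm I}}+\alpha D_{X_{\rm O}Y_{\rm O}}$ belongs to $\mathscr{D}^{\mu,b}_{XY}$; and (ii) for every $D_{XY}\in\mathscr{D}^{\mu,b}_{XY}$ the measure $\tfrac12 D_{X_{\rm I}}+\tfrac12 D_{X_{\rm O}}$ has a density $f$ with respect to $\mu$ with $1/b\le f\le b$ on ${\rm supp}\,\mu$. Let $\mathcal{H}$ be a nonempty set of measurable functions $\mathcal{X}\to\mathcal{Y}_{\rm all}$. A finite set $C\subset\mathcal{X}$ is \emph{shattered} by $\mathcal{H}$ if there are $f_0,f_1:C\to\mathcal{Y}_{\rm all}$ with $f_0(x)\ne f_1(x)$ for all $x\in C$ such that for every $B\subset C$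 some $h\in\mathcal{H}$ equals $f_0$ on $B$ and $f_1$ on $C\setminus B$; the \emph{Natarajan dimension} of $\mathcal{H}$ is the supremum of the sizes of the finite sets it shatters. \textbf{Theorem.} Let $\mathscr{D}^{\mu,b}_{XY}$ be a density-based space with $\mu(\mathcal{X})<+\infty$. Suppose that the Realizability Assumption holds, that is, for every $D_{XY}\in\mathscr{D}^{\mu,b}_{XY}$ there is $h^*\in\mathcal{H}$ with $R_D(h^*)=0$, and that $\mathcal{H}$ has finite Natarajan dimension. Then OOD detection is learnable, and strongly learnable, in $\mathscr{D}^{\mu,b}_{XY}$ for $\mathcal{H}$, with rate $O(1/\sqrt{n^{1-\theta}})$ for every $\theta\in(0,1)$. That is, there are an algorithm $\mathbf{A}:\bigcup_{n\ge 1}(\mathcal{X}\times\mathcal{Y})^n\to\mathcal{H}$ and a nonincreasing sequence $\epsilon_{\rm cons}(n)\to 0$ such that for every $D_{XY}\in\mathscr{D}^{\mu,b}_{XY}$ and every $n\ge 1$ (the expectations being well defined) $$\mathbb{E}_{S\sim D^n_{X_{\rm I}Y_{\rm I}}}\Big[R_D(\mathbf{A}(S))-\inf_{h\in\mathcal{H}}R_D(h)\Big]\le\epsilon_{\rm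 cons}(n),$$ $$\mathbb{E}_{S\sim D^n_{X_{\rm I}Y_{\rm I}}}\Big[R^{\alpha}_D(\mathbf{A}(S))-\inf_{h\in\mathcal{H}}R^{\alpha}_D(h)\Big]\le\epsilon_{\rm cons}(n)\quad\text{for all }\alpha\in[0,1],$$ and, for every $\theta\in(0,1)$, $\epsilon_{\rm cons}(n)=O(1/\sqrt{n^{1-\theta}})$ as $n\to\infty$. -/

import Mathlib

open MeasureTheory Filter
open scoped ENNReal

noncomputable section

namespace OODDetection

/-- A domain over the feature space `X`: an in-distribution (ID) joint law on `X × {ID labels}`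
(`K` ID labels), an out-of-distribution (OOD) feature law on `X` (all OOD data carry the single
extra label), and the class-prior probability `prior ∈ [0, 1)` of OOD data. -/
structure Domain (X : Type) [MeasurableSpace X] (K : ℕ) where
  idLaw : Measure (X × Fin K)
  oodLaw : Measure X
  prior : ℝ
  isProb_id : IsProbabilityMeasure idLaw
  isProb_ood : IsProbabilityMeasure oodLaw
  prior_nonneg : 0 ≤ prior
  prior_lt_one : prior < 1

variable {X : Type} [MeasurableSpace X] {K : ℕ}

namespace Domain

/-- The ID joint law, seen on `X × {all labels}`. The labels are `Fin (K + 1)`: the ID labels are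
`Fin.castSucc y` for `y : Fin K`, and the OOD label is `Fin.last K`. -/
def idJoint (D : Domain X K) : Measure (X × Fin (K + 1)) :=
  D.idLaw.map (fun p => (p.1, Fin.castSucc p.2))

/-- The OOD joint law on `X × {all labels}`: the label is almost surely the OOD label. -/
def oodJoint (D : Domain X K) : Measure (X × Fin (K + 1)) :=
  D.oodLaw.map (fun x => (x, Fin.last K))

/-- The mixture `D_XY = (1 - π) D_ID + π D_OOD`, where `π` is the OOD prior. -/
def joint (D : Domain X K) : Measure (X × Fin (K + 1)) :=
  ENNReal.ofReal (1 - D.prior) • D.idJoint + ENNReal.ofReal D.prior • D.oodJoint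

/-- The ID feature marginal. -/
def idMarginal (D : Domain X K) : Measure X := D.idLaw.map Prod.fst

/-- The domain with the same ID and OOD laws and with OOD prior `α`. -/
def withPrior (D : Domain X K) (α : ℝ) (h0 : 0 ≤ α) (h1 : α < 1) : Domain X K :=
  { D with prior := α, prior_nonneg := h0, prior_lt_one := h1 }

end Domain

/-- A loss on the labels: nonnegative, and zero exactly on the diagonal. -/
def IsLoss (ℓ : Fin (K + 1) → Fin (K + 1) → ℝ) : Prop :=
  (∀ y₁ y₂, 0 ≤ ℓ y₁ y₂) ∧ ∀ y₁ y₂, ℓ y₁ y₂ = 0 ↔ y₁ = y₂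

/-- The risk `R_D(h)` with respect to the mixture. -/
def risk (ℓ : Fin (K + 1) → Fin (K + 1) → ℝ) (D : Domain X K) (h : X → Fin (K + 1)) : ℝ :=
  ∫ p, ℓ (h p.1) p.2 ∂D.joint

/-- The ID risk. -/
def riskIn (ℓ : Fin (K + 1) → Fin (K + 1) → ℝ) (D : Domain X K) (h : X → Fin (K + 1)) : ℝ :=
  ∫ p, ℓ (h p.1) (Fin.castSucc p.2) ∂D.idLaw

/-- The OOD risk. -/
def riskOut (ℓ : Fin (K + 1) → Fin (K + 1) → ℝ) (D : Domain X K) (h : X → Fin (K + 1)) : ℝ :=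
  ∫ x, ℓ (h x) (Fin.last K) ∂D.oodLaw

/-- The `α`-risk. -/
def riskAlpha (ℓ : Fin (K + 1) → Fin (K + 1) → ℝ) (α : ℝ) (D : Domain X K)
    (h : X → Fin (K + 1)) : ℝ :=
  (1 - α) * riskIn ℓ D h + α * riskOut ℓ D h

/-- A learning algorithm: it maps every labelled ID sample, of any size `n`, to a hypothesis in
`H`. (Its value on the empty sample plays no role.) -/
abbrev Algorithm (H : Set (X → Fin (K + 1))) : Type :=
  ∀ n : ℕ, (Fin n → X × Fin K) → H

/-- The law of an i.i.d. sample of size `n` from the ID joint law. -/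
def sampleLaw (D : Domain X K) (n : ℕ) : Measure (Fin n → X × Fin K) :=
  Measure.pi (fun _ => D.idLaw)

/-- The sequence `ε` is nonincreasing, tends to `0`, and bounds the expected excess risk of `A`
on every domain of the domain space. The expectation is required to exist. -/
def ConsistentWith (ℓ : Fin (K + 1) → Fin (K + 1) → ℝ) (𝒟 : Set (Domain X K))
    (H : Set (X → Fin (K + 1))) (A : Algorithm H) (ε : ℕ → ℝ) : Prop :=
  Antitone ε ∧ Tendsto ε atTop (nhds 0) ∧
    ∀ D ∈ 𝒟, ∀ n : ℕ, 1 ≤ n →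
      Integrable (fun S => risk ℓ D (A n S) - ⨅ h : H, risk ℓ D h) (sampleLaw D n) ∧
      ∫ S, (risk ℓ D (A n S) - ⨅ h : H, risk ℓ D h) ∂sampleLaw D n ≤ ε n

/-- The same for the `α`-risks, uniformly in `α ∈ [0, 1]`. -/
def StronglyConsistentWith (ℓ : Fin (K + 1) → Fin (K + 1) → ℝ) (𝒟 : Set (Domain X K))
    (H : Set (X → Fin (K + 1))) (A : Algorithm H) (ε : ℕ → ℝ) : Prop :=
  Antitone ε ∧ Tendsto ε atTop (nhds 0) ∧
    ∀ D ∈ 𝒟, ∀ n : ℕ, 1 ≤ n → ∀ α ∈ Set.Icc (0 : ℝ) 1,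
      Integrable (fun S => riskAlpha ℓ α D (A n S) - ⨅ h : H, riskAlpha ℓ α D h)
        (sampleLaw D n) ∧
      ∫ S, (riskAlpha ℓ α D (A n S) - ⨅ h : H, riskAlpha ℓ α D h) ∂sampleLaw D n ≤ ε n

/-- A domain space is prior-unknown if it is closed under changing the OOD prior to any
`α ∈ [0, 1)`. -/
def IsPriorUnknown (𝒟 : Set (Domain X K)) : Prop :=
  ∀ D ∈ 𝒟, ∀ (α : ℝ) (h0 : 0 ≤ α) (h1 : α < 1), D.withPrior α h0 h1 ∈ 𝒟

/-- A density-based space for `μ` and `b`: a prior-unknown space such that for each of its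
domains, the half-half mixture of the ID and OOD feature laws has a density with respect to `μ`
with values in `[1/b, b]` on the support of `μ`. -/
def IsDensityBased [TopologicalSpace X] (μ : Measure X) (b : ℝ) (𝒟 : Set (Domain X K)) : Prop :=
  IsPriorUnknown 𝒟 ∧
    ∀ D ∈ 𝒟, ∃ f : X → ℝ, Measurable f ∧ (∀ x ∈ μ.support, 1 / b ≤ f x ∧ f x ≤ b) ∧
      (2⁻¹ : ℝ≥0∞) • D.idMarginal + (2⁻¹ : ℝ≥0∞) • D.oodLaw =
        μ.withDensity (fun x => ENNReal.ofReal (f x))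

/-- The Realizability Assumption. -/
def Realizable (ℓ : Fin (K + 1) → Fin (K + 1) → ℝ) (𝒟 : Set (Domain X K))
    (H : Set (X → Fin (K + 1))) : Prop :=
  ∀ D ∈ 𝒟, ∃ h ∈ H, risk ℓ D h = 0

/-- `H` shatters the finite set `C` in the sense of Natarajan. -/
def NatarajanShatters {X Y : Type} (H : Set (X → Y)) (C : Finset X) : Prop :=
  ∃ f₀ f₁ : X → Y, (∀ x ∈ C, f₀ x ≠ f₁ x) ∧
    ∀ B ⊆ C, ∃ h ∈ H, (∀ x ∈ B, h x = f₀ x) ∧ ∀ x ∈ C, x ∉ B → h x = f₁ x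

/-- The Natarajan dimension: the supremum of the sizes of shattered finite sets. -/
def natarajanDim {X Y : Type} (H : Set (X → Y)) : ℕ∞ :=
  ⨆ (C : Finset X) (_ : NatarajanShatters H C), (C.card : ℕ∞)

end OODDetection

end

/-! The learner sees no OOD data, but the domains of the space share one scale: their half-half
feature mixtures are all comparable, with constant `b ^ 2`, to the mixture `ν` of any one fixed
domain. So the `ν`-volume of the region that a hypothesis calls OOD can stand in for the missing
data. Among the members of a finite `1 / n²`-net of `H` in L¹(`ν`) that fit the ID sample, the
learner takes one whose OOD region has the largest volume.

Realizability at prior 1/2 gives a hypothesis `h₀` that is almost surely right on ID and OOD data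
alike (`exists_perfect`). With high probability its net approximation fits the sample and every
fitting net member has small ID error. The chosen OOD region is then nearly as large as that of
`h₀`. Its part outside the latter carries no OOD mass, and its ID mass counts as error, so that part
is small; hence so is what the chosen region misses (`oodLaw_real_ne_last_le`). The union bound over
the net is affordable because finite Natarajan dimension makes its size polynomial in `n`
(`exists_net`). The expected risk is `O(log n / n)`, and it dominates the expected excess risk. -/

namespace OODDetection

/-! ### Natarajan's lemma and finite nets in L¹ -/

open Classical in
/-- Natarajan's lemma: a finite class that is separated by `C` and shatters no subset of `C` with
more than `d` points has at most `(1 + |Y|² |C|) ^ d` members. -/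
theorem card_le_of_forall_natarajanShatters {X Y : Type} [Fintype Y] (C : Finset X) :
    ∀ (d : ℕ) (F : Finset (X → Y)),
      (∀ f ∈ F, ∀ g ∈ F, (∀ x ∈ C, f x = g x) → f = g) →
      (∀ T ⊆ C, NatarajanShatters (F : Set (X → Y)) T → T.card ≤ d) →
      F.card ≤ (1 + Fintype.card Y ^ 2 * C.card) ^ d := by
  induction C using Finset.induction_on with
  | empty =>
    intro d F hsep _
    simpa using Finset.card_le_one.2 fun f hf g hg => hsep f hf g hg (by simp)
  | insert a C ha ih =>
    intro d F hsep hsh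
    cases d with
    | zero =>
      simp only [pow_zero]
      refine Finset.card_le_one.2 fun f hf g hg => ?_
      by_contra hfg
      obtain ⟨x, hx, hxfg⟩ : ∃ x ∈ insert a C, f x ≠ g x := by
        by_contra! h
        exact hfg (hsep f hf g hg h)
      -- Two distinct functions already shatter a point at which they differ.
      have := hsh {x} (by simpa using hx) ⟨f, g, by simpa using hxfg, fun B hB => by
        by_cases hxB : x ∈ B
        · refine ⟨f, hf, fun _ _ => rfl, fun y hy hyB => ?_⟩
          rw [Finset.mem_singleton.1 hy] at hyB
          exact absurd hxB hyB
        · refine ⟨g, hg, fun y hy => ?_, fun _ _ _ => rfl⟩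
          have := Finset.mem_singleton.1 (hB hy)
          exact absurd (this ▸ hy) hxB⟩
      simp at this
    | succ d =>
      let ρ : (X → Y) → (C → Y) := fun f x => f x
      -- `F₁` keeps one representative of each restriction to `C`. Every discarded `f` has a twin in
      -- `F₁` that agrees with it on `C` and differs at `a`; the classes `G (i, j)` sort such `f` by
      -- the two values at `a`.
      obtain ⟨F₁, hF₁, himg, hinj⟩ : ∃ F₁ ⊆ F, F₁.image ρ = F.image ρ ∧
          Set.InjOn ρ (F₁ : Set (X → Y)) := by
        obtain ⟨u, hu, h1, h2⟩ := Finset.exists_subset_injOn_image_eq_of_surjOn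
          (f := ρ) F (F.image ρ) (by simp [Set.surjOn_image])
        exact ⟨u, by exact_mod_cast hu, by exact_mod_cast h2, h1⟩
      let G : Y × Y → Finset (X → Y) := fun q =>
        F.filter fun f => f a = q.1 ∧ q.1 ≠ q.2 ∧ ∃ g ∈ F, g a = q.2 ∧ ∀ x ∈ C, g x = f x
      have hcover : F ⊆ F₁ ∪ Finset.univ.biUnion G := by
        intro f hf
        by_cases hf₁ : f ∈ F₁
        · exact Finset.mem_union_left _ hf₁
        · obtain ⟨g, hg, hgf⟩ := Finset.mem_image.1 (himg ▸ Finset.mem_image_of_mem ρ hf)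
          have hC : ∀ x ∈ C, g x = f x := fun x hx => congrFun hgf ⟨x, hx⟩
          have hne : f a ≠ g a := fun h => hf₁ <| by
            have : g = f := hsep g (hF₁ hg) f hf fun x hx => by
              rcases Finset.mem_insert.1 hx with rfl | hx
              · exact h.symm
              · exact hC x hx
            exact this ▸ hg
          refine Finset.mem_union_right _ (Finset.mem_biUnion.2 ⟨(f a, g a), Finset.mem_univ _, ?_⟩)
          exact Finset.mem_filter.2 ⟨hf, rfl, hne, g, hF₁ hg, rfl, hC⟩
      have hF₁card : F₁.card ≤ (1 + Fintype.card Y ^ 2 * C.card) ^ (d + 1) := by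
        refine ih (d + 1) F₁ (fun f hf g hg h => hinj hf hg (funext fun x => h x x.2)) ?_
        rintro T hT ⟨f₀, f₁, hne, h⟩
        refine hsh T (hT.trans (Finset.subset_insert _ _)) ⟨f₀, f₁, hne, fun B hB => ?_⟩
        obtain ⟨f, hf, hf'⟩ := h B hB
        exact ⟨f, hF₁ hf, hf'⟩
      have hGcard : ∀ q, (G q).card ≤ (1 + Fintype.card Y ^ 2 * C.card) ^ d := by
        rintro ⟨i, j⟩
        refine ih d (G (i, j)) ?_ ?_
        · intro f hf g hg h
          obtain ⟨hf, hfa, -⟩ := Finset.mem_filter.1 hf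
          obtain ⟨hg, hga, -⟩ := Finset.mem_filter.1 hg
          refine hsep f hf g hg fun x hx => ?_
          rcases Finset.mem_insert.1 hx with rfl | hx
          · exact hfa.trans hga.symm
          · exact h x hx
        · rintro T hT ⟨f₀, f₁, hne, h⟩
          have haT : a ∉ T := fun h => ha (hT h)
          have hij : i ≠ j := by
            obtain ⟨f, hf, -⟩ := h ∅ (by simp)
            exact (Finset.mem_filter.1 hf).2.2.1
          have key := hsh (insert a T) (Finset.insert_subset_insert _ hT)
            ⟨Function.update f₀ a i, Function.update f₁ a j, ?_, ?_⟩
          · rw [Finset.card_insert_of_notMem haT] at key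
            omega
          · intro x hx
            rcases Finset.mem_insert.1 hx with rfl | hx
            · simpa using hij
            · have : x ≠ a := fun h => haT (h ▸ hx)
              simpa [this] using hne x hx
          · intro B hB
            obtain ⟨f, hf, h0, h1⟩ := h (B.erase a) (by
              intro x hx
              obtain ⟨hxa, hx⟩ := Finset.mem_erase.1 hx
              exact (Finset.mem_insert.1 (hB hx)).resolve_left hxa)
            obtain ⟨hfF, hfa, -, g, hg, hga, hgf⟩ := Finset.mem_filter.1 hf
            have hB0 : ∀ x ∈ B, x ≠ a → f x = f₀ x := fun x hx hxa =>
              h0 x (Finset.mem_erase.2 ⟨hxa, hx⟩)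
            have hB1 : ∀ x ∈ insert a T, x ∉ B → x ≠ a → f x = f₁ x := fun x hx hxB hxa =>
              h1 x ((Finset.mem_insert.1 hx).resolve_left hxa) fun h => hxB (Finset.mem_of_mem_erase h)
            have hgf' : ∀ x ∈ insert a T, x ≠ a → g x = f x := fun x hx hxa =>
              hgf x (hT ((Finset.mem_insert.1 hx).resolve_left hxa))
            -- The twin `g` supplies the value `j` at `a` without changing anything on `T`, so a set
            -- shattered by `G (i, j)` stays shattered by `F` after adding `a`. This is why the
            -- dimension drops by one.
            by_cases haB : a ∈ B
            · refine ⟨f, hfF, fun x hx => ?_, fun x hx hxB => ?_⟩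
              · by_cases hxa : x = a
                · subst hxa; simpa using hfa
                · simpa [hxa] using hB0 x hx hxa
              · have hxa : x ≠ a := fun h => hxB (h ▸ haB)
                simpa [hxa] using hB1 x hx hxB hxa
            · refine ⟨g, hg, fun x hx => ?_, fun x hx hxB => ?_⟩
              · have hxa : x ≠ a := fun h => haB (h ▸ hx)
                simpa [hxa, hgf' x (hB hx) hxa] using hB0 x hx hxa
              · by_cases hxa : x = a
                · subst hxa; simpa using hga
                · simpa [hxa, hgf' x hx hxa] using hB1 x hx hxB hxa
      set k := Fintype.card Y ^ 2 with hk
      set m := C.card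
      have hsum : (Finset.univ.biUnion G).card ≤ k * (1 + k * m) ^ d := by
        refine Finset.card_biUnion_le.trans ((Finset.sum_le_card_nsmul _ _ _ fun q _ => hGcard q).trans ?_)
        simp [hk, sq]
      rw [Finset.card_insert_of_notMem ha]
      calc F.card ≤ (1 + k * m) ^ (d + 1) + k * (1 + k * m) ^ d :=
            (Finset.card_le_card hcover).trans ((Finset.card_union_le _ _).trans
              (add_le_add hF₁card hsum))
        _ = (1 + k * (m + 1)) * (1 + k * m) ^ d := by ring
        _ ≤ (1 + k * (m + 1)) * (1 + k * (m + 1)) ^ d := by gcongr; omega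
        _ = (1 + k * (m + 1)) ^ (d + 1) := by ring

open Classical in
/-- Choosing points greedily, `m` points leave at most a `(1 - ε) ^ m` fraction of the pairs of an
`ε`-separated finite class undistinguished. -/
theorem exists_finset_card_undistinguished_le {X Y : Type} [MeasurableSpace X] [MeasurableSpace Y]
    [MeasurableEq Y] (ν : Measure X) [IsProbabilityMeasure ν]
    (F : Finset (X → Y)) (hF : ∀ f ∈ F, Measurable f) {ε : ℝ} (hε : ε ≤ 1)
    (hsep : ∀ f ∈ F, ∀ g ∈ F, f ≠ g → ε ≤ ν.real {x | f x ≠ g x}) (m : ℕ) :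
    ∃ C : Finset X, C.card ≤ m ∧
      (((F ×ˢ F).filter fun p => p.1 ≠ p.2 ∧ ∀ x ∈ C, p.1 x = p.2 x).card : ℝ) ≤
        (1 - ε) ^ m * (F.card : ℝ) ^ 2 := by
  induction m with
  | zero =>
    refine ⟨∅, by simp, ?_⟩
    have := Finset.card_filter_le (F ×ˢ F) fun p => p.1 ≠ p.2 ∧ ∀ x ∈ (∅ : Finset X), p.1 x = p.2 x
    rw [Finset.card_product, ← sq] at this
    simpa only [pow_zero, one_mul] using (by exact_mod_cast this : (_ : ℝ) ≤ (F.card : ℝ) ^ 2)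
  | succ m ih =>
    obtain ⟨C, hC, hcard⟩ := ih
    set P := (F ×ˢ F).filter fun p => p.1 ≠ p.2 ∧ ∀ x ∈ C, p.1 x = p.2 x
    have hP : ∀ p ∈ P, p.1 ∈ F ∧ p.2 ∈ F ∧ p.1 ≠ p.2 := fun p hp => by
      have := Finset.mem_filter.1 hp
      exact ⟨(Finset.mem_product.1 this.1).1, (Finset.mem_product.1 this.1).2, this.2.1⟩
    have hmeas : ∀ p ∈ P, MeasurableSet {x | p.1 x = p.2 x} := fun p hp =>
      measurableSet_eq_fun (hF _ (hP p hp).1) (hF _ (hP p hp).2.1)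
    have hinteg : ∀ p ∈ P, Integrable (({x | p.1 x = p.2 x} : Set X).indicator fun _ => (1 : ℝ)) ν :=
      fun p hp => (integrable_const 1).indicator (hmeas p hp)
    -- Averaging over `ν`: some point leaves at most the mean number of pairs undistinguished.
    obtain ⟨x, hx⟩ := exists_le_integral (integrable_finsetSum P hinteg)
    have hle : ∫ x, ∑ p ∈ P, ({x | p.1 x = p.2 x} : Set X).indicator (fun _ => (1 : ℝ)) x ∂ν ≤
        (1 - ε) * P.card := by
      rw [integral_finsetSum P hinteg, mul_comm, ← nsmul_eq_mul]
      refine Finset.sum_le_card_nsmul _ _ _ fun p hp => ?_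
      rw [integral_indicator_const _ (hmeas p hp)]
      have h1 := hsep _ (hP p hp).1 _ (hP p hp).2.1 (hP p hp).2.2
      have h2 := probReal_compl_eq_one_sub (μ := ν) (hmeas p hp)
      have h3 : ({x | p.1 x = p.2 x} : Set X)ᶜ = {x | p.1 x ≠ p.2 x} := rfl
      rw [h3] at h2
      simp only [smul_eq_mul, mul_one]
      linarith
    refine ⟨insert x C, (Finset.card_insert_le _ _).trans (by omega), ?_⟩
    have hsub : ((F ×ˢ F).filter fun p => p.1 ≠ p.2 ∧ ∀ y ∈ insert x C, p.1 y = p.2 y) ⊆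
        P.filter fun p => p.1 x = p.2 x := by
      intro p hp
      obtain ⟨h1, h2, h3⟩ := Finset.mem_filter.1 hp
      exact Finset.mem_filter.2 ⟨Finset.mem_filter.2 ⟨h1, h2, fun y hy =>
        h3 y (Finset.mem_insert_of_mem hy)⟩, h3 x (Finset.mem_insert_self _ _)⟩
    calc _ ≤ ((P.filter fun p => p.1 x = p.2 x).card : ℝ) := by
          exact_mod_cast Finset.card_le_card hsub
      _ = ∑ p ∈ P, ({x | p.1 x = p.2 x} : Set X).indicator (fun _ => (1 : ℝ)) x := by
          simp [Set.indicator_apply]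
      _ ≤ (1 - ε) * P.card := hx.trans hle
      _ ≤ (1 - ε) * ((1 - ε) ^ m * (F.card : ℝ) ^ 2) := by
          gcongr
      _ = _ := by ring

/-- A logarithmic self-bound is an absolute bound. -/
theorem le_of_le_mul_log {L a : ℝ} {d : ℕ} (hL : 0 ≤ L) (ha : 0 < a)
    (h : L ≤ d * Real.log (a * (1 + L))) :
    L ≤ 2 * d * (Real.log a + 2 * d) + 1 := by
  rcases Nat.eq_zero_or_pos d with rfl | hd
  · simp at h ⊢; linarith
  have hd' : (1 : ℝ) ≤ d := by exact_mod_cast hd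
  -- Scaling by `2 * d` before using `log y ≤ y - 1` leaves only `L / 2` on the right after
  -- multiplication by `d`, and this is absorbed on the left.
  have hlog : Real.log (1 + L) ≤ (1 + L) / (2 * d) - 1 + 2 * d := by
    have h1 : Real.log ((1 + L) / (2 * d)) ≤ (1 + L) / (2 * d) - 1 :=
      Real.log_le_sub_one_of_pos (by positivity)
    have h2 : Real.log (2 * d) ≤ 2 * d - 1 := Real.log_le_sub_one_of_pos (by positivity)
    rw [Real.log_div (by positivity) (by positivity)] at h1
    linarith
  rw [Real.log_mul ha.ne' (by positivity)] at h
  have h3 : (d : ℝ) * ((1 + L) / (2 * d)) = (1 + L) / 2 := by field_simp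
  nlinarith [mul_le_mul_of_nonneg_left hlog (by positivity : (0 : ℝ) ≤ d)]

/-- The size of a finite class that is `1 / n²`-separated is at most polynomial in `n`. -/
theorem log_card_le_of_separated {X Y : Type} [MeasurableSpace X] [Fintype Y] [MeasurableSpace Y]
    [MeasurableEq Y] (ν : Measure X) [IsProbabilityMeasure ν] {d n : ℕ} (hn : 1 ≤ n)
    (F : Finset (X → Y)) (hF : ∀ f ∈ F, Measurable f)
    (hdim : ∀ T, NatarajanShatters (F : Set (X → Y)) T → T.card ≤ d)
    (hsep : ∀ f ∈ F, ∀ g ∈ F, f ≠ g → 1 / (n : ℝ) ^ 2 ≤ ν.real {x | f x ≠ g x}) :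
    Real.log F.card ≤ 2 * d * (Real.log (5 * (1 + (Fintype.card Y : ℝ) ^ 2)) +
      2 * Real.log n + 2 * d) + 1 := by
  classical
  have hn' : (1 : ℝ) ≤ n := by exact_mod_cast hn
  rcases Nat.eq_zero_or_pos F.card with h0 | hpos
  -- Here `Real.log 0 = 0`, so it suffices that the bound is nonnegative.
  · rw [h0]
    have h1 : 0 ≤ Real.log (n : ℝ) := Real.log_nonneg hn'
    have h2 : 0 ≤ Real.log (5 * (1 + (Fintype.card Y : ℝ) ^ 2)) :=
      Real.log_nonneg (by nlinarith [sq_nonneg (Fintype.card Y : ℝ)])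
    simp only [Nat.cast_zero, Real.log_zero]
    positivity
  have hN : (1 : ℝ) ≤ F.card := by exact_mod_cast hpos
  set L := Real.log F.card with hLdef
  have hL : 0 ≤ L := Real.log_nonneg hN
  -- With more than `2 n² L` points, fewer than one pair is left undistinguished, hence none.
  set m := ⌊2 * (n : ℝ) ^ 2 * L⌋₊ + 1 with hm
  have hm1 : 2 * (n : ℝ) ^ 2 * L < m := by
    rw [hm]; push_cast; exact Nat.lt_floor_add_one _
  have hm2 : (m : ℝ) ≤ 2 * (n : ℝ) ^ 2 * L + 1 := by
    rw [hm]; push_cast; linarith [Nat.floor_le (by positivity : 0 ≤ 2 * (n : ℝ) ^ 2 * L)]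
  have hε : 1 / (n : ℝ) ^ 2 ≤ 1 := by
    rw [div_le_one (by positivity)]; exact one_le_pow₀ hn'
  obtain ⟨C, hCm, hC⟩ := exists_finset_card_undistinguished_le ν F hF hε hsep m
  have hlt : (1 - 1 / (n : ℝ) ^ 2) ^ m * (F.card : ℝ) ^ 2 < 1 := by
    calc (1 - 1 / (n : ℝ) ^ 2) ^ m * (F.card : ℝ) ^ 2
        ≤ Real.exp (-(1 / (n : ℝ) ^ 2)) ^ m * Real.exp L ^ 2 := by
          rw [hLdef, Real.exp_log (by linarith)]
          gcongr
          linarith [Real.add_one_le_exp (-(1 / (n : ℝ) ^ 2))]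
      _ = Real.exp (-(m / (n : ℝ) ^ 2) + 2 * L) := by
          rw [← Real.exp_nat_mul, ← Real.exp_nat_mul, ← Real.exp_add]
          congr 1; push_cast; ring
      _ < 1 := by
          rw [Real.exp_lt_one_iff]
          have : 2 * L < m / (n : ℝ) ^ 2 := by
            rw [lt_div_iff₀ (by positivity)]; linarith
          linarith
  have hempty : ((F ×ˢ F).filter fun p => p.1 ≠ p.2 ∧ ∀ x ∈ C, p.1 x = p.2 x) = ∅ := by
    rw [← Finset.card_eq_zero]
    have := hC.trans_lt hlt
    exact_mod_cast Nat.lt_one_iff.1 (by exact_mod_cast this)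
  have hbound := card_le_of_forall_natarajanShatters C d F (fun f hf g hg h => by
    by_contra hne
    have : (f, g) ∈ (∅ : Finset ((X → Y) × (X → Y))) := by
      rw [← hempty]
      exact Finset.mem_filter.2 ⟨Finset.mem_product.2 ⟨hf, hg⟩, hne, h⟩
    simp at this) (fun T _ => hdim T)
  have hbound' : (F.card : ℝ) ≤
      (5 * (1 + (Fintype.card Y : ℝ) ^ 2) * (n : ℝ) ^ 2 * (1 + L)) ^ d := by
    have h1 : (F.card : ℝ) ≤ (1 + (Fintype.card Y : ℝ) ^ 2 * C.card) ^ d := by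
      exact_mod_cast hbound
    refine h1.trans (pow_le_pow_left₀ (by positivity) ?_ d)
    have h2 : (C.card : ℝ) ≤ 2 * (n : ℝ) ^ 2 * L + 1 := le_trans (by exact_mod_cast hCm) hm2
    have h3 : (1 : ℝ) ≤ (n : ℝ) ^ 2 := one_le_pow₀ hn'
    set q := (Fintype.card Y : ℝ) ^ 2
    have hq : 0 ≤ q := by positivity
    calc 1 + q * C.card ≤ 1 + q * (2 * (n : ℝ) ^ 2 * L + 1) := by gcongr
      _ ≤ (1 + q) * (2 * (n : ℝ) ^ 2 * L + (n : ℝ) ^ 2) := by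
        have : 0 ≤ (n : ℝ) ^ 2 * L := by positivity
        nlinarith
      _ ≤ (1 + q) * (5 * (n : ℝ) ^ 2 * L + 5 * (n : ℝ) ^ 2) := by
        gcongr
        · norm_num
        · linarith
      _ = _ := by ring
  -- The size of `C` was itself bounded through `L`, so this is a self-bound, to be resolved by
  -- `le_of_le_mul_log`.
  have hlog : L ≤ d * Real.log (5 * (1 + (Fintype.card Y : ℝ) ^ 2) * (n : ℝ) ^ 2 * (1 + L)) := by
    rw [← Real.log_pow]
    exact Real.log_le_log (by linarith) hbound'
  have := le_of_le_mul_log hL (by positivity) hlog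
  rwa [Real.log_mul (by positivity) (by positivity), Real.log_pow, Nat.cast_ofNat] at this

/-- A class of finite Natarajan dimension has, for each `n ≥ 1`, a finite `1 / n²`-net in `L¹(ν)`
whose size is at most polynomial in `n`. -/
theorem exists_net {X Y : Type} [MeasurableSpace X] [Fintype Y] [MeasurableSpace Y]
    [MeasurableEq Y] (ν : Measure X) [IsProbabilityMeasure ν] (H : Set (X → Y))
    (hmeas : ∀ h ∈ H, Measurable h) (hdim : natarajanDim H < ⊤) :
    ∃ B : ℝ, 0 ≤ B ∧ ∀ n : ℕ, 1 ≤ n → ∃ F : Finset (X → Y), (F : Set (X → Y)) ⊆ H ∧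
      Real.log F.card ≤ B * (1 + Real.log n) ∧
      ∀ h ∈ H, ∃ g ∈ F, ν.real {x | g x ≠ h x} ≤ 1 / (n : ℝ) ^ 2 := by
  classical
  obtain ⟨d, hd⟩ := ENat.ne_top_iff_exists.1 hdim.ne
  have hT : ∀ F : Finset (X → Y), (F : Set (X → Y)) ⊆ H →
      ∀ T, NatarajanShatters (F : Set (X → Y)) T → T.card ≤ d := by
    rintro F hFH T ⟨f₀, f₁, hne, h⟩
    have hTH : NatarajanShatters H T := ⟨f₀, f₁, hne, fun B hB => by
      obtain ⟨f, hf, hf'⟩ := h B hB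
      exact ⟨f, hFH hf, hf'⟩⟩
    have : (T.card : ℕ∞) ≤ natarajanDim H :=
      le_iSup₂ (f := fun (C : Finset X) (_ : NatarajanShatters H C) => (C.card : ℕ∞)) T hTH
    rw [← hd] at this
    exact_mod_cast this
  set a := Real.log (5 * (1 + (Fintype.card Y : ℝ) ^ 2)) with ha
  have ha0 : 0 ≤ a := Real.log_nonneg (by nlinarith [sq_nonneg (Fintype.card Y : ℝ)])
  refine ⟨2 * d * (a + 2 + 2 * d) + 1, by positivity, fun n hn => ?_⟩
  have hln : 0 ≤ Real.log (n : ℝ) := Real.log_nonneg (by exact_mod_cast hn)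
  let Sep : Finset (X → Y) → Prop := fun F => (F : Set (X → Y)) ⊆ H ∧
    ∀ f ∈ F, ∀ g ∈ F, f ≠ g → 1 / (n : ℝ) ^ 2 ≤ ν.real {x | f x ≠ g x}
  have hbd : ∀ F, Sep F → Real.log F.card ≤ (2 * d * (a + 2 + 2 * d) + 1) * (1 + Real.log n) := by
    intro F hF
    refine (log_card_le_of_separated ν hn F (fun f hf => hmeas f (hF.1 hf)) (hT F hF.1) hF.2).trans ?_
    have : (0 : ℝ) ≤ d := by positivity
    nlinarith [mul_nonneg this hln, mul_nonneg (mul_nonneg this hln) ha0,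
      mul_nonneg (mul_nonneg this this) hln]
  set N := ⌊Real.exp ((2 * d * (a + 2 + 2 * d) + 1) * (1 + Real.log n))⌋₊
  have hcard : ∀ F, Sep F → F.card ≤ N := by
    intro F hF
    rcases Nat.eq_zero_or_pos F.card with h0 | hpos
    · omega
    · exact Nat.le_floor ((Real.log_le_iff_le_exp (by exact_mod_cast hpos)).1 (hbd F hF))
  obtain ⟨F, hF, hmax⟩ : ∃ F, Sep F ∧ ∀ F', Sep F' → F'.card ≤ F.card := by
    by_contra! hcon
    have : ∀ k : ℕ, ∃ F, Sep F ∧ k ≤ F.card := by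
      intro k
      induction k with
      | zero => exact ⟨∅, ⟨by simp, by simp⟩, by simp⟩
      | succ k ih =>
        obtain ⟨F, hF, hk⟩ := ih
        obtain ⟨F', hF', hlt⟩ := hcon F hF
        exact ⟨F', hF', by omega⟩
    obtain ⟨F, hF, hk⟩ := this (N + 1)
    have := hcard F hF
    omega
  refine ⟨F, hF.1, hbd F hF, fun h hh => ?_⟩
  -- A hypothesis far from all of `F` could be added to it, against maximality.
  by_contra! hfar
  have hpos : (0 : ℝ) ≤ 1 / (n : ℝ) ^ 2 := by positivity
  have hnot : h ∉ F := fun hhF => by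
    have := hfar h hhF
    simp at this
    linarith [sq_nonneg (n : ℝ)]
  have := hmax (insert h F) ⟨by
    simpa [Set.insert_subset_iff] using ⟨hh, hF.1⟩, by
    intro f hf g hg hne
    rcases Finset.mem_insert.1 hf with hf' | hf' <;> rcases Finset.mem_insert.1 hg with hg' | hg'
    · exact absurd (hf'.trans hg'.symm) hne
    · subst hf'; simpa only [ne_comm] using (hfar g hg').le
    · subst hg'; exact (hfar f hf').le
    · exact hF.2 f hf' g hg' hne⟩
  rw [Finset.card_insert_of_notMem hnot] at this
  omega

/-! ### Consistency with a sample and measurable selection -/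

variable {X : Type} [MeasurableSpace X] {K : ℕ}

attribute [instance] Domain.isProb_id Domain.isProb_ood

instance (D : Domain X K) : IsProbabilityMeasure D.idMarginal :=
  Measure.isProbabilityMeasure_map measurable_fst.aemeasurable

instance (D : Domain X K) (n : ℕ) : IsProbabilityMeasure (sampleLaw D n) := by
  unfold sampleLaw; infer_instance

/-- The set of labelled ID points that `h` misclassifies. -/
def errorSet (h : X → Fin (K + 1)) : Set (X × Fin K) := {p | h p.1 ≠ Fin.castSucc p.2}

theorem measurableSet_errorSet {h : X → Fin (K + 1)} (hh : Measurable h) :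
    MeasurableSet (errorSet h) :=
  (measurableSet_eq_fun (hh.comp measurable_fst)
    ((measurable_of_finite _).comp measurable_snd)).compl

/-- `h` makes no error on the sample `S`. -/
def IsConsistent {n : ℕ} (h : X → Fin (K + 1)) (S : Fin n → X × Fin K) : Prop :=
  ∀ i, S i ∉ errorSet h

theorem measurableSet_isConsistent {n : ℕ} {h : X → Fin (K + 1)} (hh : Measurable h) :
    MeasurableSet {S : Fin n → X × Fin K | IsConsistent h S} := by
  have : {S : Fin n → X × Fin K | IsConsistent h S} =
      Set.univ.pi fun _ => (errorSet h)ᶜ := by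
    ext S; simp [IsConsistent]
  rw [this]
  exact MeasurableSet.univ_pi fun _ => (measurableSet_errorSet hh).compl

theorem sampleLaw_real_isConsistent (D : Domain X K) (n : ℕ) {h : X → Fin (K + 1)}
    (hh : Measurable h) :
    (sampleLaw D n).real {S | IsConsistent h S} = (1 - D.idLaw.real (errorSet h)) ^ n := by
  have : {S : Fin n → X × Fin K | IsConsistent h S} =
      Set.univ.pi fun _ => (errorSet h)ᶜ := by
    ext S; simp [IsConsistent]
  rw [this, ← probReal_compl_eq_one_sub (measurableSet_errorSet hh)]
  simp [sampleLaw, measureReal_def, Measure.pi_pi]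

/-- Bernoulli's inequality applied to the exact probability of consistency. -/
theorem sampleLaw_real_not_isConsistent_le (D : Domain X K) (n : ℕ) {h : X → Fin (K + 1)}
    (hh : Measurable h) :
    (sampleLaw D n).real {S | ¬ IsConsistent h S} ≤ n * D.idLaw.real (errorSet h) := by
  have h1 : {S : Fin n → X × Fin K | ¬ IsConsistent h S} = {S | IsConsistent h S}ᶜ := rfl
  rw [h1, probReal_compl_eq_one_sub (measurableSet_isConsistent hh),
    sampleLaw_real_isConsistent D n hh]
  have h2 : D.idLaw.real (errorSet h) ≤ 1 := measureReal_le_one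
  have h3 := one_add_mul_le_pow (a := -D.idLaw.real (errorSet h)) (by linarith) n
  rw [← sub_eq_add_neg] at h3
  linarith

/-- Among the members of a finite class that are consistent with the sample, one can select a
maximizer of any weight in a measurable way. -/
theorem exists_measurable_selection {H : Set (X → Fin (K + 1))} (hH : H.Nonempty)
    (hmeas : ∀ h ∈ H, Measurable h) (F : Finset (X → Fin (K + 1)))
    (hF : (F : Set (X → Fin (K + 1))) ⊆ H) (w : (X → Fin (K + 1)) → ℝ) (n : ℕ) :
    ∃ A : (Fin n → X × Fin K) → H, (∀ φ : H → ℝ, Measurable fun S => φ (A S)) ∧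
      ∀ S, ∀ g ∈ F, IsConsistent g S →
        (A S).1 ∈ F ∧ IsConsistent (A S).1 S ∧ w g ≤ w (A S).1 := by
  classical
  -- The choice depends on the sample only through the set `P` of consistent members. There are
  -- finitely many such sets, so every function of the choice is measurable, with no σ-algebra on
  -- `H`.
  have hsel : ∀ P : F → Prop, ∃ h : H, ∀ g : F, P g →
      ∃ h' : F, h'.1 = h.1 ∧ P h' ∧ w g.1 ≤ w h'.1 := by
    intro P
    by_cases hP : ∃ g, P g
    · obtain ⟨g, hg⟩ := hP
      obtain ⟨h, hh, hmax⟩ := Finset.exists_max_image (Finset.univ.filter P) (fun g => w g.1)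
        ⟨g, by simpa using hg⟩
      exact ⟨⟨h.1, hF h.2⟩, fun g hg => ⟨h, rfl, by simpa using hh, hmax g (by simpa using hg)⟩⟩
    · exact ⟨⟨_, hH.some_mem⟩, fun g hg => absurd ⟨g, hg⟩ hP⟩
  choose sel hsel using hsel
  let T : (Fin n → X × Fin K) → F → Prop := fun S g => IsConsistent g.1 S
  have hT : Measurable T := measurable_pi_iff.2 fun g =>
    measurableSet_setOfPred.1 (measurableSet_isConsistent (hmeas _ (hF g.2)))
  refine ⟨fun S => sel (T S), fun φ => ?_, fun S g hg hcons => ?_⟩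
  · have : Measurable fun P : F → Prop => φ (sel P) := .of_discrete
    exact this.comp hT
  · obtain ⟨h', h1, h2, h3⟩ := hsel (T S) ⟨g, hg⟩ hcons
    rw [← h1]
    exact ⟨h'.2, h2, h3⟩

/-! ### Losses and risks -/

section Loss

variable {ℓ : Fin (K + 1) → Fin (K + 1) → ℝ}

/-- The total of all losses: an upper bound for the loss. -/
def lossBound (ℓ : Fin (K + 1) → Fin (K + 1) → ℝ) : ℝ := ∑ q : Fin (K + 1) × Fin (K + 1), ℓ q.1 q.2

theorem IsLoss.le_lossBound (hℓ : IsLoss ℓ) (i j : Fin (K + 1)) : ℓ i j ≤ lossBound ℓ :=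
  Finset.single_le_sum (f := fun q : Fin (K + 1) × Fin (K + 1) => ℓ q.1 q.2)
    (fun q _ => hℓ.1 q.1 q.2) (Finset.mem_univ (i, j))

theorem IsLoss.lossBound_nonneg (hℓ : IsLoss ℓ) : 0 ≤ lossBound ℓ :=
  Finset.sum_nonneg fun q _ => hℓ.1 q.1 q.2

theorem IsLoss.integrable {Ω : Type} [MeasurableSpace Ω] (hℓ : IsLoss ℓ) (P : Measure Ω)
    [IsFiniteMeasure P] {u v : Ω → Fin (K + 1)} (hu : Measurable u) (hv : Measurable v) :
    Integrable (fun ω => ℓ (u ω) (v ω)) P := by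
  have hm : Measurable fun ω => ℓ (u ω) (v ω) :=
    (measurable_of_finite fun q : Fin (K + 1) × Fin (K + 1) => ℓ q.1 q.2).comp (hu.prodMk hv)
  refine Integrable.of_bound hm.aestronglyMeasurable (lossBound ℓ) (.of_forall fun ω => ?_)
  rw [Real.norm_of_nonneg (hℓ.1 _ _)]
  exact hℓ.le_lossBound _ _

theorem IsLoss.integral_le {Ω : Type} [MeasurableSpace Ω] (hℓ : IsLoss ℓ) (P : Measure Ω)
    [IsFiniteMeasure P] {u v : Ω → Fin (K + 1)} (hu : Measurable u) (hv : Measurable v) :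
    ∫ ω, ℓ (u ω) (v ω) ∂P ≤ lossBound ℓ * P.real {ω | u ω ≠ v ω} := by
  have hs : MeasurableSet {ω | u ω ≠ v ω} := (measurableSet_eq_fun hu hv).compl
  rw [mul_comm, ← smul_eq_mul, ← integral_indicator_const _ hs]
  refine integral_mono (hℓ.integrable P hu hv) ((integrable_const _).indicator hs) fun ω => ?_
  by_cases h : u ω = v ω
  · simp [h, (hℓ.2 (v ω) (v ω)).2 rfl]
  · simpa [h] using hℓ.le_lossBound _ _

theorem IsLoss.ae_eq_of_integral_eq_zero {Ω : Type} [MeasurableSpace Ω] (hℓ : IsLoss ℓ)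
    (P : Measure Ω) [IsFiniteMeasure P] {u v : Ω → Fin (K + 1)} (hu : Measurable u)
    (hv : Measurable v) (h : ∫ ω, ℓ (u ω) (v ω) ∂P = 0) : ∀ᵐ ω ∂P, u ω = v ω := by
  rw [integral_eq_zero_iff_of_nonneg (fun ω => hℓ.1 _ _) (hℓ.integrable P hu hv)] at h
  filter_upwards [h] with ω hω using (hℓ.2 _ _).1 hω

theorem riskIn_nonneg (hℓ : IsLoss ℓ) (D : Domain X K) (h : X → Fin (K + 1)) : 0 ≤ riskIn ℓ D h :=
  integral_nonneg fun _ => hℓ.1 _ _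

theorem riskOut_nonneg (hℓ : IsLoss ℓ) (D : Domain X K) (h : X → Fin (K + 1)) :
    0 ≤ riskOut ℓ D h :=
  integral_nonneg fun _ => hℓ.1 _ _

theorem riskIn_le (hℓ : IsLoss ℓ) (D : Domain X K) {h : X → Fin (K + 1)} (hh : Measurable h) :
    riskIn ℓ D h ≤ lossBound ℓ * D.idLaw.real (errorSet h) :=
  hℓ.integral_le D.idLaw (hh.comp measurable_fst) ((measurable_of_finite _).comp measurable_snd)

theorem riskOut_le (hℓ : IsLoss ℓ) (D : Domain X K) {h : X → Fin (K + 1)} (hh : Measurable h) :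
    riskOut ℓ D h ≤ lossBound ℓ * D.oodLaw.real {x | h x ≠ Fin.last K} :=
  hℓ.integral_le D.oodLaw hh measurable_const

/-- This makes consistency the case `α = D.prior` of strong consistency, and splits realizability
into an ID and an OOD part. -/
theorem risk_eq_riskAlpha (hℓ : IsLoss ℓ) (D : Domain X K) {h : X → Fin (K + 1)}
    (hh : Measurable h) : risk ℓ D h = riskAlpha ℓ D.prior D h := by
  have hi : Measurable fun p : X × Fin K => (p.1, Fin.castSucc p.2) :=
    measurable_fst.prodMk ((measurable_of_finite _).comp measurable_snd)
  have ho : Measurable fun x : X => (x, Fin.last K) := measurable_id.prodMk measurable_const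
  have hm : Measurable fun p : X × Fin (K + 1) => ℓ (h p.1) p.2 :=
    (measurable_of_finite fun q : Fin (K + 1) × Fin (K + 1) => ℓ q.1 q.2).comp
      ((hh.comp measurable_fst).prodMk measurable_snd)
  have : IsProbabilityMeasure D.idJoint := Measure.isProbabilityMeasure_map hi.aemeasurable
  have : IsProbabilityMeasure D.oodJoint := Measure.isProbabilityMeasure_map ho.aemeasurable
  have hinteg (P : Measure (X × Fin (K + 1))) [IsFiniteMeasure P] :
      Integrable (fun p : X × Fin (K + 1) => ℓ (h p.1) p.2) P :=
    hℓ.integrable P (hh.comp measurable_fst) measurable_snd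
  unfold risk riskAlpha Domain.joint
  rw [integral_add_measure ((hinteg _).smul_measure ENNReal.ofReal_ne_top)
    ((hinteg _).smul_measure ENNReal.ofReal_ne_top), integral_smul_measure, integral_smul_measure,
    ENNReal.toReal_ofReal (by linarith [D.prior_lt_one]), ENNReal.toReal_ofReal D.prior_nonneg,
    Domain.idJoint, Domain.oodJoint, integral_map hi.aemeasurable hm.aestronglyMeasurable,
    integral_map ho.aemeasurable hm.aestronglyMeasurable]
  rfl

theorem riskAlpha_nonneg (hℓ : IsLoss ℓ) (D : Domain X K) {α : ℝ} (hα : α ∈ Set.Icc (0 : ℝ) 1)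
    (h : X → Fin (K + 1)) : 0 ≤ riskAlpha ℓ α D h :=
  add_nonneg (mul_nonneg (by linarith [hα.2]) (riskIn_nonneg hℓ D h))
    (mul_nonneg hα.1 (riskOut_nonneg hℓ D h))

theorem riskAlpha_le (hℓ : IsLoss ℓ) (D : Domain X K) {α r : ℝ} (hα : α ∈ Set.Icc (0 : ℝ) 1)
    {h : X → Fin (K + 1)} (hh : Measurable h) (hi : D.idLaw.real (errorSet h) ≤ r)
    (ho : D.oodLaw.real {x | h x ≠ Fin.last K} ≤ r) :
    riskAlpha ℓ α D h ≤ lossBound ℓ * r := by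
  have h1 := (riskIn_le hℓ D hh).trans (mul_le_mul_of_nonneg_left hi hℓ.lossBound_nonneg)
  have h2 := (riskOut_le hℓ D hh).trans (mul_le_mul_of_nonneg_left ho hℓ.lossBound_nonneg)
  unfold riskAlpha
  nlinarith [hα.1, hα.2]

/-- Under realizability, every domain has a hypothesis that is almost surely right on both the ID
and the OOD data. -/
theorem exists_perfect (hℓ : IsLoss ℓ) {𝒟 : Set (Domain X K)} {H : Set (X → Fin (K + 1))}
    (hmeas : ∀ h ∈ H, Measurable h) (hprior : IsPriorUnknown 𝒟) (hreal : Realizable ℓ 𝒟 H)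
    {D : Domain X K} (hD : D ∈ 𝒟) :
    ∃ h ∈ H, D.idLaw (errorSet h) = 0 ∧ D.oodLaw {x | h x ≠ Fin.last K} = 0 := by
  -- The prior of `D` may be 0, which says nothing about OOD data. Prior 1/2 gives both risks
  -- positive weight and keeps both laws.
  obtain ⟨h, hh, hrisk⟩ := hreal _ (hprior D hD (1 / 2) (by norm_num) (by norm_num))
  rw [risk_eq_riskAlpha hℓ _ (hmeas h hh)] at hrisk
  have h0 : (1 - 1 / 2 : ℝ) * riskIn ℓ D h + 1 / 2 * riskOut ℓ D h = 0 := hrisk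
  have h1 := riskIn_nonneg hℓ D h
  have h2 := riskOut_nonneg hℓ D h
  refine ⟨h, hh, ae_iff.1 ?_, ae_iff.1 ?_⟩
  · exact hℓ.ae_eq_of_integral_eq_zero D.idLaw ((hmeas h hh).comp measurable_fst)
      ((measurable_of_finite _).comp measurable_snd) (by change riskIn ℓ D h = 0; linarith)
  · exact hℓ.ae_eq_of_integral_eq_zero D.oodLaw (hmeas h hh) measurable_const
      (by change riskOut ℓ D h = 0; linarith)

end Loss

/-! ### OOD error from volume -/

/-- `ν` and the half-half mixture of the feature laws of `D` dominate each other with constant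
`c`. -/
def IsComparable (ν : Measure X) (c : ℝ) (D : Domain X K) : Prop :=
  ∀ s, MeasurableSet s →
    D.idMarginal.real s + D.oodLaw.real s ≤ 2 * c * ν.real s ∧
      2 * ν.real s ≤ c * (D.idMarginal.real s + D.oodLaw.real s)

theorem idMarginal_real_le_of_subset (D : Domain X K) {s : Set X} (hs : MeasurableSet s)
    {t : Set (X × Fin K)} (h : ∀ p, p.1 ∈ s → p ∈ t) : D.idMarginal.real s ≤ D.idLaw.real t := by
  rw [Domain.idMarginal, map_measureReal_apply measurable_fst hs]
  exact measureReal_mono h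

section Comparable

variable {ν : Measure X} {c : ℝ} {D : Domain X K}
  {h₀ g : X → Fin (K + 1)}

/-- Almost surely `h₀` makes no ID error, so `g` errs only where the two differ. -/
theorem idLaw_real_errorSet_le_of_approx (hcomp : IsComparable ν c D) (hc : 0 ≤ c)
    (hh₀ : Measurable h₀) (hg : Measurable g) (hin : D.idLaw (errorSet h₀) = 0) {η : ℝ}
    (hgh : ν.real {x | g x ≠ h₀ x} ≤ η) : D.idLaw.real (errorSet g) ≤ 2 * c * η := by
  have hs : MeasurableSet {x | g x ≠ h₀ x} := (measurableSet_eq_fun hg hh₀).compl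
  have hsub : errorSet g ⊆ errorSet h₀ ∪ Prod.fst ⁻¹' {x | g x ≠ h₀ x} := by
    intro p hp
    by_cases h : g p.1 = h₀ p.1
    · exact .inl fun h' => hp (h.trans h')
    · exact .inr h
  calc D.idLaw.real (errorSet g) ≤ D.idLaw.real (errorSet h₀) +
        D.idLaw.real (Prod.fst ⁻¹' {x | g x ≠ h₀ x}) :=
        (measureReal_mono hsub).trans (measureReal_union_le _ _)
    _ = D.idMarginal.real {x | g x ≠ h₀ x} := by
        rw [Domain.idMarginal, map_measureReal_apply measurable_fst hs]
        simp [measureReal_def, hin]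
    _ ≤ 2 * c * ν.real {x | g x ≠ h₀ x} := by
        linarith [(hcomp _ hs).1, measureReal_nonneg (μ := D.oodLaw) (s := {x | g x ≠ h₀ x})]
    _ ≤ 2 * c * η := by gcongr

/-- A hypothesis with small ID error whose OOD region is nearly as large as that of an approximation
of the perfect hypothesis has small OOD error. -/
theorem oodLaw_real_ne_last_le [IsFiniteMeasure ν] (hcomp : IsComparable ν c D) (hc : 0 ≤ c)
    (hh₀ : Measurable h₀) (hout : D.oodLaw {x | h₀ x ≠ Fin.last K} = 0)
    {η t : ℝ} (hgh : ν.real {x | g x ≠ h₀ x} ≤ η) {h : X → Fin (K + 1)} (hh : Measurable h)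
    (hle : ν.real {x | g x = Fin.last K} ≤ ν.real {x | h x = Fin.last K})
    (ht : D.idLaw.real (errorSet h) ≤ t) :
    D.oodLaw.real {x | h x ≠ Fin.last K} ≤ c ^ 2 * t + 2 * c * η := by
  have hmeas {f : X → Fin (K + 1)} (hf : Measurable f) : MeasurableSet {x | f x = Fin.last K} :=
    measurableSet_eq_fun hf measurable_const
  set U := {x | h x = Fin.last K}
  set V := {x | h₀ x = Fin.last K}
  have hU : MeasurableSet U := hmeas hh
  have hV : MeasurableSet V := hmeas hh₀
  have hVc : D.oodLaw.real Vᶜ = 0 := by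
    have : D.oodLaw Vᶜ = 0 := hout
    simp [measureReal_def, this]
  have h1 : D.oodLaw.real Uᶜ ≤ D.oodLaw.real (V \ U) := by
    have : Uᶜ ⊆ (V \ U) ∪ Vᶜ := fun x hx => by
      by_cases hxV : x ∈ V
      · exact .inl ⟨hxV, hx⟩
      · exact .inr hxV
    have := (measureReal_mono (μ := D.oodLaw) this).trans (measureReal_union_le _ _)
    linarith
  have h2 : D.oodLaw.real (V \ U) ≤ 2 * c * ν.real (V \ U) := by
    linarith [(hcomp _ (hV.diff hU)).1, measureReal_nonneg (μ := D.idMarginal) (s := V \ U)]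
  have h3 : ν.real V ≤ ν.real U + η := by
    have : V ⊆ {x | g x = Fin.last K} ∪ {x | g x ≠ h₀ x} := fun x hx => by
      by_cases hgx : g x = h₀ x
      · exact .inl (hgx.trans hx)
      · exact .inr hgx
    have := (measureReal_mono (μ := ν) this).trans (measureReal_union_le _ _)
    linarith
  -- Cancelling the common part `U ∩ V` turns `h3` into `ν (V \ U) ≤ ν (U \ V) + η`.
  have h4 := measureReal_sdiff_add_inter (μ := ν) (s := V) hU
  have h5 := measureReal_sdiff_add_inter (μ := ν) (s := U) hV
  rw [Set.inter_comm] at h5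
  -- On `U \ V` there is no OOD mass, and `h` calls every ID point there OOD, which is an error.
  have h6 : 2 * ν.real (U \ V) ≤ c * t := by
    refine (hcomp _ (hU.diff hV)).2.trans (mul_le_mul_of_nonneg_left ?_ hc)
    have h7 : D.oodLaw.real (U \ V) ≤ 0 := by
      rw [← hVc]; exact measureReal_mono fun x hx => hx.2
    have h8 : D.idMarginal.real (U \ V) ≤ D.idLaw.real (errorSet h) :=
      idMarginal_real_le_of_subset D (hU.diff hV) fun p hp hp' => by
        have : h p.1 = Fin.last K := hp.1
        exact absurd (hp'.symm.trans this) (Fin.castSucc_lt_last _).ne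
    linarith
  calc D.oodLaw.real Uᶜ ≤ 2 * c * ν.real (V \ U) := h1.trans h2
    _ ≤ 2 * c * (c * t / 2 + η) := by
      gcongr; linarith
    _ = _ := by ring

end Comparable

/-! ### The learner and its expected risk -/

/-- The event that the approximation `g` errs on the sample, or that some member of `F` with ID error
above `t` does not. -/
def misleadingSamples (D : Domain X K) (n : ℕ) (F : Finset (X → Fin (K + 1)))
    (g : X → Fin (K + 1)) (t : ℝ) : Set (Fin n → X × Fin K) :=
  {S | ¬ IsConsistent g S} ∪
    ⋃ h ∈ F, {S | t < D.idLaw.real (errorSet h) ∧ IsConsistent h S}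

theorem measurableSet_misleadingSamples (D : Domain X K) (n : ℕ) {F : Finset (X → Fin (K + 1))}
    (hF : ∀ f ∈ F, Measurable f) {g : X → Fin (K + 1)} (hg : Measurable g) (t : ℝ) :
    MeasurableSet (misleadingSamples D n F g t) :=
  (measurableSet_isConsistent hg).compl.union <| F.measurableSet_biUnion fun h hh =>
    (MeasurableSet.const _).inter (measurableSet_isConsistent (hF h hh))

theorem sampleLaw_real_misleadingSamples_le (D : Domain X K) (n : ℕ)
    {F : Finset (X → Fin (K + 1))} (hF : ∀ f ∈ F, Measurable f) {g : X → Fin (K + 1)}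
    (hg : Measurable g) (t : ℝ) :
    (sampleLaw D n).real (misleadingSamples D n F g t) ≤
      n * D.idLaw.real (errorSet g) + F.card * Real.exp (-(n * t)) := by
  refine (measureReal_union_le _ _).trans
    (add_le_add (sampleLaw_real_not_isConsistent_le D n hg) ?_)
  refine (measureReal_biUnion_finset_le _ _).trans ?_
  rw [← nsmul_eq_mul]
  refine Finset.sum_le_card_nsmul _ _ _ fun h hh => ?_
  by_cases ht : t < D.idLaw.real (errorSet h)
  · have hle : D.idLaw.real (errorSet h) ≤ 1 := measureReal_le_one
    simp only [ht, true_and]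
    rw [sampleLaw_real_isConsistent D n (hF h hh)]
    calc (1 - D.idLaw.real (errorSet h)) ^ n ≤ Real.exp (-t) ^ n := by
          refine pow_le_pow_left₀ (by linarith) ?_ n
          linarith [Real.add_one_le_exp (-t)]
      _ = Real.exp (-(n * t)) := by
          rw [← Real.exp_nat_mul]; congr 1; ring
  · simp only [ht, false_and, Set.ofPred_false, measureReal_empty]
    positivity

/-- Expected `α`-risk of a learner that selects, among the members of the net `F` that are
consistent with the sample, one with the largest OOD region. -/
theorem integral_riskAlpha_le {ℓ : Fin (K + 1) → Fin (K + 1) → ℝ} (hℓ : IsLoss ℓ)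
    {H : Set (X → Fin (K + 1))} (hmeas : ∀ h ∈ H, Measurable h)
    {ν : Measure X} [IsProbabilityMeasure ν] {c : ℝ} (hc : 0 ≤ c) {D : Domain X K}
    (hcomp : IsComparable ν c D) {n : ℕ} {F : Finset (X → Fin (K + 1))}
    (hF : (F : Set (X → Fin (K + 1))) ⊆ H) {h₀ g : X → Fin (K + 1)} (hh₀ : Measurable h₀)
    (hin : D.idLaw (errorSet h₀) = 0) (hout : D.oodLaw {x | h₀ x ≠ Fin.last K} = 0)
    (hg : g ∈ F) {η : ℝ} (hη : 0 ≤ η) (hgh : ν.real {x | g x ≠ h₀ x} ≤ η)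
    {A : (Fin n → X × Fin K) → H} (hA : ∀ φ : H → ℝ, Measurable fun S => φ (A S))
    (hsel : ∀ S, ∀ g ∈ F, IsConsistent g S → (A S).1 ∈ F ∧ IsConsistent (A S).1 S ∧
      ν.real {x | g x = Fin.last K} ≤ ν.real {x | (A S).1 x = Fin.last K})
    {α : ℝ} (hα : α ∈ Set.Icc (0 : ℝ) 1) {t : ℝ} (ht : 0 ≤ t) :
    Integrable (fun S => riskAlpha ℓ α D (A S)) (sampleLaw D n) ∧
      ∫ S, riskAlpha ℓ α D (A S) ∂sampleLaw D n ≤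
        lossBound ℓ * ((1 + c ^ 2) * t + 2 * c * η +
          (n * (2 * c * η) + F.card * Real.exp (-(n * t)))) := by
  have hFm : ∀ f ∈ F, Measurable f := fun f hf => hmeas f (hF hf)
  have hL := hℓ.lossBound_nonneg
  have hAm : ∀ S, Measurable (A S).1 := fun S => hmeas _ (A S).2
  have hle1 : ∀ S, riskAlpha ℓ α D (A S) ≤ lossBound ℓ := fun S => by
    simpa using riskAlpha_le hℓ D hα (hAm S) measureReal_le_one measureReal_le_one
  have hinteg : Integrable (fun S => riskAlpha ℓ α D (A S)) (sampleLaw D n) := by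
    refine Integrable.of_bound (hA fun h => riskAlpha ℓ α D h).aestronglyMeasurable (lossBound ℓ)
      (.of_forall fun S => ?_)
    rw [Real.norm_of_nonneg (riskAlpha_nonneg hℓ D hα _)]
    exact hle1 S
  refine ⟨hinteg, ?_⟩
  set M := misleadingSamples D n F g t
  have hM : MeasurableSet M := measurableSet_misleadingSamples D n hFm (hFm g hg) t
  set r := (1 + c ^ 2) * t + 2 * c * η
  have hr : 0 ≤ r := by positivity
  -- On misleading samples only the trivial bound by `lossBound ℓ` is used.
  have hpt : ∀ S, riskAlpha ℓ α D (A S) ≤ lossBound ℓ * r + M.indicator (fun _ => lossBound ℓ) S := by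
    intro S
    by_cases hS : S ∈ M
    · rw [Set.indicator_of_mem hS]
      have := hle1 S
      have := mul_nonneg hL hr
      linarith
    · rw [Set.indicator_of_notMem hS, add_zero]
      have hcons : IsConsistent g S := by
        by_contra h
        exact hS (.inl h)
      obtain ⟨h1, h2, h3⟩ := hsel S g hg hcons
      have herr : D.idLaw.real (errorSet (A S).1) ≤ t := by
        by_contra! h
        exact hS (.inr (Set.mem_biUnion h1 ⟨h, h2⟩))
      have hood := oodLaw_real_ne_last_le hcomp hc hh₀ hout hgh (hAm S) h3 herr
      refine riskAlpha_le hℓ D hα (hAm S) (herr.trans ?_) (hood.trans ?_)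
      · have : 0 ≤ c ^ 2 * t + 2 * c * η := by positivity
        simp only [r]; linarith
      · simp only [r]; linarith
  calc ∫ S, riskAlpha ℓ α D (A S) ∂sampleLaw D n
      ≤ ∫ S, (lossBound ℓ * r + M.indicator (fun _ => lossBound ℓ) S) ∂sampleLaw D n :=
        integral_mono hinteg ((integrable_const _).add ((integrable_const _).indicator hM)) hpt
    _ = lossBound ℓ * (r + (sampleLaw D n).real M) := by
        rw [integral_add (integrable_const _) ((integrable_const _).indicator hM),
          integral_indicator_const _ hM]
        simp; ring
    _ ≤ lossBound ℓ * (r + (n * (2 * c * η) + F.card * Real.exp (-(n * t)))) := by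
        gcongr
        refine (sampleLaw_real_misleadingSamples_le D n hFm (hFm g hg) t).trans ?_
        gcongr
        exact idLaw_real_errorSet_le_of_approx hcomp hc hh₀ (hFm g hg) hin hgh

/-- For domains comparable to a common probability measure, a class of finite Natarajan dimension
has a learner with expected `α`-risk `O(log n / n)`. -/
theorem exists_algorithm {ℓ : Fin (K + 1) → Fin (K + 1) → ℝ} (hℓ : IsLoss ℓ)
    {H : Set (X → Fin (K + 1))} (hH : H.Nonempty) (hmeas : ∀ h ∈ H, Measurable h)
    (hdim : natarajanDim H < ⊤) {𝒟 : Set (Domain X K)} (hprior : IsPriorUnknown 𝒟)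
    (hreal : Realizable ℓ 𝒟 H) (ν : Measure X) [IsProbabilityMeasure ν] {c : ℝ} (hc : 0 ≤ c)
    (hcomp : ∀ D ∈ 𝒟, IsComparable ν c D) :
    ∃ (A : Algorithm H) (B : ℝ), 0 ≤ B ∧ ∀ D ∈ 𝒟, ∀ n : ℕ, 1 ≤ n → ∀ α ∈ Set.Icc (0 : ℝ) 1,
      Integrable (fun S => riskAlpha ℓ α D (A n S)) (sampleLaw D n) ∧
      ∫ S, riskAlpha ℓ α D (A n S) ∂sampleLaw D n ≤ B * ((1 + Real.log n) / n) := by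
  obtain ⟨B, hB, hnet⟩ := exists_net ν H hmeas hdim
  -- Net and selection depend on `ν` and `n` but on no domain, so one algorithm serves all of `𝒟`.
  -- For `n = 0` the values are arbitrary.
  have hA : ∀ n : ℕ, ∃ (F : Finset (X → Fin (K + 1))) (A : (Fin n → X × Fin K) → H), 1 ≤ n →
      (F : Set (X → Fin (K + 1))) ⊆ H ∧ Real.log F.card ≤ B * (1 + Real.log n) ∧
      (∀ h ∈ H, ∃ g ∈ F, ν.real {x | g x ≠ h x} ≤ 1 / (n : ℝ) ^ 2) ∧
      (∀ φ : H → ℝ, Measurable fun S => φ (A S)) ∧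
      ∀ S, ∀ g ∈ F, IsConsistent g S → (A S).1 ∈ F ∧ IsConsistent (A S).1 S ∧
        ν.real {x | g x = Fin.last K} ≤ ν.real {x | (A S).1 x = Fin.last K} := by
    intro n
    by_cases hn : 1 ≤ n
    · obtain ⟨F, hF, hlog, happrox⟩ := hnet n hn
      obtain ⟨A, hA, hsel⟩ := exists_measurable_selection hH hmeas F hF
        (fun h => ν.real {x | h x = Fin.last K}) n
      exact ⟨F, A, fun _ => ⟨hF, hlog, happrox, hA, hsel⟩⟩
    · exact ⟨∅, fun _ => ⟨_, hH.some_mem⟩, fun h => absurd h hn⟩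
  choose F A hA using hA
  have hL := hℓ.lossBound_nonneg
  refine ⟨A, lossBound ℓ * ((1 + c ^ 2) * (B + 1) + 4 * c + 1), by positivity, ?_⟩
  intro D hD n hn α hα
  obtain ⟨hF, hlog, happrox, hAm, hsel⟩ := hA n hn
  obtain ⟨h₀, hh₀, hin, hout⟩ := exists_perfect hℓ hmeas hprior hreal hD
  obtain ⟨g, hg, hgh⟩ := happrox h₀ hh₀
  have hn1 : (1 : ℝ) ≤ n := by exact_mod_cast hn
  have hln : 0 ≤ Real.log (n : ℝ) := Real.log_nonneg hn1
  have hcard : (1 : ℝ) ≤ (F n).card := by exact_mod_cast Finset.card_pos.2 ⟨g, hg⟩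
  -- Chosen so that the union bound `|F| exp (-n t)` equals `1 / n`.
  set t := (Real.log (F n).card + Real.log n) / n with ht
  have ht0 : 0 ≤ t := div_nonneg (add_nonneg (Real.log_nonneg hcard) hln) (by linarith)
  obtain ⟨hinteg, hle⟩ := integral_riskAlpha_le hℓ hmeas hc (hcomp D hD) hF (hmeas h₀ hh₀) hin hout hg
    (by positivity) hgh hAm hsel hα ht0
  refine ⟨hinteg, hle.trans ?_⟩
  rw [mul_assoc (lossBound ℓ)]
  refine mul_le_mul_of_nonneg_left ?_ hL
  have hexp : (F n).card * Real.exp (-(n * t)) = 1 / n := by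
    have : (n : ℝ) * t = Real.log (F n).card + Real.log n := by rw [ht]; field_simp
    rw [this, neg_add, Real.exp_add, Real.exp_neg, Real.exp_neg, Real.exp_log (by linarith),
      Real.exp_log (by linarith)]
    field_simp
  set q := (1 + Real.log (n : ℝ)) / n with hq
  have h1 : t ≤ (B + 1) * q := by
    rw [ht, hq, ← mul_div_assoc]
    gcongr
    linarith
  have h2 : 1 / (n : ℝ) ≤ q := by rw [hq]; gcongr; linarith
  have h3 : 1 / (n : ℝ) ^ 2 ≤ 1 / n := by
    gcongr; nlinarith
  -- The net has scale `1 / n²` so that even `n` draws reveal an error of the approximation with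
  -- probability `O(1 / n)`.
  have h4 : (n : ℝ) * (2 * c * (1 / (n : ℝ) ^ 2)) = 2 * c * (1 / n) := by field_simp
  rw [hexp, h4]
  calc (1 + c ^ 2) * t + 2 * c * (1 / (n : ℝ) ^ 2) + (2 * c * (1 / n) + 1 / n)
      ≤ (1 + c ^ 2) * ((B + 1) * q) + 2 * c * q + (2 * c * q + q) := by
        gcongr; exact h3.trans h2
    _ = _ := by ring

/-! ### Density-based spaces -/

/-- The half-half mixture of the ID and OOD feature laws. -/
noncomputable def Domain.mixture (D : Domain X K) : Measure X :=
  (2⁻¹ : ℝ≥0∞) • D.idMarginal + (2⁻¹ : ℝ≥0∞) • D.oodLaw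

instance (D : Domain X K) : IsProbabilityMeasure D.mixture :=
  ⟨by simp [Domain.mixture, ENNReal.inv_two_add_inv_two]⟩

theorem Domain.two_mul_mixture_real (D : Domain X K) (s : Set X) :
    2 * D.mixture.real s = D.idMarginal.real s + D.oodLaw.real s := by
  simp only [Domain.mixture, measureReal_def, Measure.add_apply, Measure.smul_apply, smul_eq_mul]
  rw [ENNReal.toReal_add (by finiteness) (by finiteness), ENNReal.toReal_mul, ENNReal.toReal_mul,
    ENNReal.toReal_inv, ENNReal.toReal_ofNat]
  ring

/-- In a hereditarily Lindelöf space the support of `μ` has full measure, so the bounds on the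
density hold almost everywhere. -/
theorem mixture_le_of_isDensityBased [TopologicalSpace X] [HereditarilyLindelofSpace X]
    {μ : Measure X} {b : ℝ} (hb : 0 < b) {𝒟 : Set (Domain X K)} (h𝒟 : IsDensityBased μ b 𝒟)
    {D : Domain X K} (hD : D ∈ 𝒟) :
    D.mixture ≤ ENNReal.ofReal b • μ ∧ μ ≤ ENNReal.ofReal b • D.mixture := by
  obtain ⟨f, hf, hfb, hfμ⟩ := h𝒟.2 D hD
  change D.mixture = _ at hfμ
  have hsupp : ∀ᵐ x ∂μ, x ∈ μ.support := Measure.support_mem_ae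
  rw [hfμ]
  constructor
  · rw [← withDensity_const]
    refine withDensity_mono ?_
    filter_upwards [hsupp] with x hx
    exact ENNReal.ofReal_le_ofReal (hfb x hx).2
  · rw [← withDensity_smul _ hf.ennreal_ofReal]
    conv_lhs => rw [← withDensity_one (μ := μ)]
    refine withDensity_mono ?_
    filter_upwards [hsupp] with x hx
    have : 1 ≤ b * f x := by
      have := (hfb x hx).1
      rwa [div_le_iff₀' hb] at this
    simp only [Pi.smul_apply, Pi.one_apply, smul_eq_mul]
    rw [← ENNReal.ofReal_mul hb.le]
    exact ENNReal.one_le_ofReal.2 this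

/-- The domains of a density-based space are mutually comparable. -/
theorem isComparable_of_isDensityBased [TopologicalSpace X] [HereditarilyLindelofSpace X]
    {μ : Measure X} {b : ℝ} (hb : 0 < b) {𝒟 : Set (Domain X K)} (h𝒟 : IsDensityBased μ b 𝒟)
    {D₀ D : Domain X K} (hD₀ : D₀ ∈ 𝒟) (hD : D ∈ 𝒟) : IsComparable D₀.mixture (b ^ 2) D := by
  -- Each passage, to `μ` and back, costs a factor `b`.
  have key : ∀ {D D' : Domain X K}, D ∈ 𝒟 → D' ∈ 𝒟 → ∀ s,
      D.mixture.real s ≤ b ^ 2 * D'.mixture.real s := by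
    intro D D' hD hD' s
    have h1 := (mixture_le_of_isDensityBased hb h𝒟 hD).1 s
    have h2 := (mixture_le_of_isDensityBased hb h𝒟 hD').2 s
    simp only [Measure.smul_apply, smul_eq_mul] at h1 h2
    have h3 : D.mixture s ≤ ENNReal.ofReal (b ^ 2) * D'.mixture s := by
      rw [sq, ENNReal.ofReal_mul hb.le, mul_assoc]
      exact h1.trans (by gcongr)
    have := ENNReal.toReal_mono (by finiteness) h3
    rwa [ENNReal.toReal_mul, ENNReal.toReal_ofReal (by positivity)] at this
  intro s _
  rw [← D.two_mul_mixture_real]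
  constructor
  · linarith [key hD hD₀ s]
  · linarith [key hD₀ hD s]

/-! ### The rate -/

/-- An antitone version of the rate `log n / n`. -/
noncomputable def logRate (n : ℕ) : ℝ := Real.log (n + 3) / (n + 3)

/-- The shift by 3 is there because `log x / x` decreases only from `e` on. -/
theorem exp_one_le_cast_add_three (n : ℕ) : Real.exp 1 ≤ (n : ℝ) + 3 := by
  linarith [Real.exp_one_lt_three, (Nat.cast_nonneg n : (0 : ℝ) ≤ n)]

theorem antitone_logRate : Antitone logRate := fun m n hmn =>
  Real.log_div_self_antitoneOn (exp_one_le_cast_add_three m) (exp_one_le_cast_add_three n)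
    (by simpa using hmn)

theorem logRate_nonneg (n : ℕ) : 0 ≤ logRate n :=
  div_nonneg (Real.log_nonneg (by linarith [(Nat.cast_nonneg n : (0 : ℝ) ≤ n)])) (by positivity)

theorem one_add_log_div_le_logRate {n : ℕ} (hn : 1 ≤ n) :
    (1 + Real.log n) / n ≤ 8 * logRate n := by
  have hn1 : (1 : ℝ) ≤ n := by exact_mod_cast hn
  have h1 : 1 ≤ Real.log ((n : ℝ) + 3) := by
    rw [Real.le_log_iff_exp_le (by positivity)]; exact exp_one_le_cast_add_three n
  have h2 : Real.log (n : ℝ) ≤ Real.log ((n : ℝ) + 3) := Real.log_le_log (by linarith) (by linarith)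
  rw [logRate, ← mul_div_assoc, div_le_div_iff₀ (by linarith) (by linarith)]
  calc (1 + Real.log n) * ((n : ℝ) + 3)
      ≤ (2 * Real.log ((n : ℝ) + 3)) * (4 * n) := by
        gcongr
        · linarith
        · linarith
    _ = _ := by ring

theorem logRate_le {n : ℕ} (hn : 1 ≤ n) : logRate n ≤ 2 / Real.sqrt n := by
  have hn1 : (1 : ℝ) ≤ n := by exact_mod_cast hn
  set x := (n : ℝ) + 3
  have hx : 0 < x := by positivity
  have hs : 0 < Real.sqrt x := Real.sqrt_pos.2 hx
  have h1 : Real.log x ≤ 2 * Real.sqrt x := by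
    have : Real.log (Real.sqrt x) = Real.log x / 2 := Real.log_sqrt hx.le
    have := Real.log_le_sub_one_of_pos hs
    linarith
  calc logRate n ≤ 2 * Real.sqrt x / x := by unfold logRate; gcongr
    _ = 2 / Real.sqrt x := by
      rw [div_eq_div_iff hx.ne' hs.ne', mul_assoc, Real.mul_self_sqrt hx.le]
    _ ≤ 2 / Real.sqrt n := by
      have : 0 < Real.sqrt n := Real.sqrt_pos.2 (by linarith)
      gcongr
      simp [x]

theorem tendsto_logRate : Tendsto logRate atTop (nhds 0) := by
  have h : Tendsto (fun n : ℕ => 2 / Real.sqrt n) atTop (nhds 0) :=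
    (Real.tendsto_sqrt_atTop.comp tendsto_natCast_atTop_atTop).const_div_atTop 2
  refine squeeze_zero' (.of_forall logRate_nonneg) ?_ h
  filter_upwards [eventually_ge_atTop 1] with n hn using logRate_le hn

/-- As `n ^ (1 - θ) ≤ n` for `n ≥ 1`, the bound `2 / √n` suffices. -/
theorem isBigO_logRate {θ : ℝ} (hθ : 0 ≤ θ) :
    logRate =O[atTop] (fun n : ℕ => 1 / Real.sqrt ((n : ℝ) ^ (1 - θ))) := by
  refine Asymptotics.IsBigO.of_bound 2 ?_
  filter_upwards [eventually_ge_atTop 1] with n hn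
  have hn1 : (1 : ℝ) ≤ n := by exact_mod_cast hn
  have hpos : 0 < Real.sqrt ((n : ℝ) ^ (1 - θ)) :=
    Real.sqrt_pos.2 (Real.rpow_pos_of_pos (by linarith) _)
  rw [Real.norm_of_nonneg (logRate_nonneg n), Real.norm_of_nonneg (by positivity), mul_one_div]
  refine (logRate_le hn).trans ?_
  gcongr
  simpa using Real.rpow_le_rpow_of_exponent_le hn1 (by linarith : 1 - θ ≤ 1)

end OODDetection

/-! ### The main theorem -/

open OODDetection in
theorem mainTheorem8 {d K : ℕ} (X : Set (EuclideanSpace ℝ (Fin d)))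
    (ℓ : Fin (K + 1) → Fin (K + 1) → ℝ) (hℓ : OODDetection.IsLoss ℓ)
    (H : Set (X → Fin (K + 1))) (hH : H.Nonempty) (hHmeas : ∀ h ∈ H, Measurable h)
    (μ : MeasureTheory.Measure X) (hμ : μ Set.univ < ⊤) (b : ℝ) (hb : 0 < b)
    (𝒟 : Set (OODDetection.Domain X K)) (h𝒟 : OODDetection.IsDensityBased μ b 𝒟)
    (hreal : OODDetection.Realizable ℓ 𝒟 H)
    (hdim : OODDetection.natarajanDim H < ⊤) :
    ∃ (A : OODDetection.Algorithm H) (ε : ℕ → ℝ),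
      OODDetection.ConsistentWith ℓ 𝒟 H A ε ∧
      OODDetection.StronglyConsistentWith ℓ 𝒟 H A ε ∧
      ∀ θ ∈ Set.Ioo (0 : ℝ) 1,
        ε =O[Filter.atTop] (fun n : ℕ => 1 / Real.sqrt ((n : ℝ) ^ (1 - θ))) := by
  obtain ⟨A, B, hB, hA⟩ : ∃ (A : Algorithm H) (B : ℝ), 0 ≤ B ∧ ∀ D ∈ 𝒟, ∀ n : ℕ, 1 ≤ n →
      ∀ α ∈ Set.Icc (0 : ℝ) 1,
      Integrable (fun S => riskAlpha ℓ α D (A n S)) (sampleLaw D n) ∧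
      ∫ S, riskAlpha ℓ α D (A n S) ∂sampleLaw D n ≤ B * ((1 + Real.log n) / n) := by
    -- Any domain provides the reference measure; without one, every algorithm will do.
    rcases 𝒟.eq_empty_or_nonempty with rfl | ⟨D₀, hD₀⟩
    · exact ⟨fun _ _ => ⟨_, hH.some_mem⟩, 0, le_rfl, fun D hD => absurd hD (by simp)⟩
    · exact exists_algorithm hℓ hH hHmeas hdim h𝒟.1 hreal D₀.mixture (sq_nonneg b)
        fun D hD => isComparable_of_isDensityBased hb h𝒟 hD₀ hD
  have hanti : Antitone fun n => 8 * B * logRate n :=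
    fun m n hmn => mul_le_mul_of_nonneg_left (antitone_logRate hmn) (by positivity)
  have htend : Tendsto (fun n => 8 * B * logRate n) atTop (nhds 0) := by
    simpa using tendsto_logRate.const_mul (8 * B)
  have hstrong : StronglyConsistentWith ℓ 𝒟 H A fun n => 8 * B * logRate n := by
    refine ⟨hanti, htend, fun D hD n hn α hα => ?_⟩
    obtain ⟨hinteg, hle⟩ := hA D hD n hn α hα
    refine ⟨hinteg.sub (integrable_const _), ?_⟩
    -- A nonnegative infimum can only lower the excess, so bounding the risk is enough.
    have hinf : 0 ≤ ⨅ h : H, riskAlpha ℓ α D h :=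
      Real.iInf_nonneg fun h => riskAlpha_nonneg hℓ D hα _
    calc ∫ S, (riskAlpha ℓ α D (A n S) - ⨅ h : H, riskAlpha ℓ α D h) ∂sampleLaw D n
        ≤ ∫ S, riskAlpha ℓ α D (A n S) ∂sampleLaw D n :=
          integral_mono (hinteg.sub (integrable_const _)) hinteg fun S => by simpa using hinf
      _ ≤ B * (8 * logRate n) := hle.trans
          (mul_le_mul_of_nonneg_left (one_add_log_div_le_logRate hn) hB)
      _ = 8 * B * logRate n := by ring
  refine ⟨A, fun n => 8 * B * logRate n, ⟨hanti, htend, fun D hD n hn => ?_⟩, hstrong,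
    fun θ hθ => (isBigO_logRate hθ.1.le).const_mul_left _⟩
  have heq : ∀ h : H, risk ℓ D h = riskAlpha ℓ D.prior D h := fun h =>
    risk_eq_riskAlpha hℓ D (hHmeas h h.2)
  simp only [heq]
  exact hstrong.2.2 D hD n hn D.prior ⟨D.prior_nonneg, D.prior_lt_one.le⟩
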